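/- Let $G$ be a finite simple graph on $n$ vertices in which every edge lies in exactly one triangle and every non-edge (pair of distinct non-adjacent vertices) lies in exactly one quadrilateral, where triangles, quadrilaterals and hexagons mean induced subgraphs isomorphic to the cycles $C_3$, $C_4$ and $C_6$, respectively. Then there is an integer $k\ge 0$ such that $G$ is strongly regular with parameters $(n,k,1,2)$, i.e. $G$ is $k$-regular, any two adjacent vertices have exactly one common neighbour and any two distinct non-adjacent vertices have exactly two, and the number $p_6$ of hexagons of $G$ satisfies \[ p_6=\tfrac{1}{12}\,nk(k-2)(2k^2-21k+53)+n_3, \] where $n_3$ is the number of induced subgraphs of $G$ isomorphic to the six-vertex graph that consists of two vertex-disjoint triangles $abc$ and $a'b'c'$ together with exactly two further edges $aa'$ and $bb'$. In particular, \[ p_6\ \ge\ \tfrac{1}{12}\,nk(k-2)(2k^2-21k+53). \] -/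

import Mathlib

/-- The vertex set `s` induces in `G` a subgraph isomorphic to `H`. -/
def InducesCopy {V W : Type*} (G : SimpleGraph V) (H : SimpleGraph W) (s : Set V) : Prop :=
  Nonempty (G.induce s ≃g H)

/-- The number of induced subgraphs of `G` that are isomorphic to `H`
(counted as vertex sets, for a finite graph `G`). -/
noncomputable def inducedCount {V W : Type*} (G : SimpleGraph V) (H : SimpleGraph W) : ℕ :=
  {s : Set V | InducesCopy G H s}.ncard

/-- Every edge lies in exactly one triangle. -/
def EdgesInUniqueTriangle {V : Type*} (G : SimpleGraph V) : Prop :=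
  ∀ u v : V, G.Adj u v →
    ∃! s : Set V, u ∈ s ∧ v ∈ s ∧ InducesCopy G (SimpleGraph.cycleGraph 3) s

/-- Every non-edge (pair of distinct non-adjacent vertices) lies in exactly one
quadrilateral, that is, in exactly one induced 4-cycle. -/
def NonEdgesInUniqueQuadrilateral {V : Type*} (G : SimpleGraph V) : Prop :=
  ∀ u v : V, u ≠ v → ¬ G.Adj u v →
    ∃! s : Set V, u ∈ s ∧ v ∈ s ∧ InducesCopy G (SimpleGraph.cycleGraph 4) s

/-- Two disjoint triangles `0 1 2` and `3 4 5` joined by exactly two disjoint edges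
`0 3` and `1 4`. -/
def doublyLinkedTriangles : SimpleGraph (Fin 6) :=
  SimpleGraph.fromEdgeSet
    {s(0, 1), s(1, 2), s(0, 2), s(3, 4), s(4, 5), s(3, 5), s(0, 3), s(1, 4)}

/-!
Call `x p y q z r` a frame if `x`, `y`, `z` are independent and, among these three, `p` is
adjacent to `x` and `y`, `q` to `y` and `z`, and `r` to `z` and `x`; a hexagon is a frame without
chords among `p`, `q`, `r`. Two non-adjacent vertices have exactly two common neighbours, so an
independent triple carries `8` frames if its vertices have no common neighbour and a single one if
they have one; this gives the number of frames. They are sieved by their chords. A frame with the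
chord `p q` is a triangle `p q y` with a path `p x r z q` attached, in which neither `x z` nor
`y r` is an edge. Both of these exceptional edges occur in equally many such configurations (once
for each induced path on three vertices), and those with `x z` but not `y r` are the labelled copies
of `doublyLinkedTriangles`, whence the term `n₃`. Frames with two chords again correspond to
induced paths on three vertices, and three chords would put an edge in two triangles.
-/

section InducedCopies

variable {V W : Type*} {G : SimpleGraph V} {H : SimpleGraph W}

theorem inducesCopy_iff_exists_embedding {s : Set V} :
    InducesCopy G H s ↔ ∃ f : H ↪g G, Set.range f = s := by
  refine ⟨fun ⟨e⟩ => ⟨(SimpleGraph.Embedding.induce s).comp e.symm.toEmbedding, ?_⟩, ?_⟩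
  · exact (e.symm.surjective.range_comp Subtype.val).trans Subtype.range_coe
  · rintro ⟨f, rfl⟩
    exact ⟨f.isoInduceRange.symm⟩

/-- Embeddings with range `s` correspond to isomorphisms onto the subgraph induced on `s`. -/
noncomputable def embeddingRangeEquiv (s : Set V) :
    {f : H ↪g G // Set.range f = s} ≃ (H ≃g G.induce s) where
  toFun f :=
    { toEquiv := (Equiv.ofInjective f.1 f.1.injective).trans (Equiv.setCongr f.2)
      map_rel_iff' := f.1.map_rel_iff }
  invFun e := ⟨(SimpleGraph.Embedding.induce s).comp e.toEmbedding,
    (e.surjective.range_comp Subtype.val).trans Subtype.range_coe⟩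
  left_inv _ := rfl
  right_inv _ := RelIso.ext fun _ => rfl

theorem card_embedding_eq_inducedCount_mul_card_aut [Finite V] [Finite W] :
    Nat.card (H ↪g G) = inducedCount G H * Nat.card (H ≃g H) := by
  have e : (H ↪g G) ≃ {s | InducesCopy G H s} × (H ≃g H) :=
    calc (H ↪g G)
      _ ≃ Σ s : {s | InducesCopy G H s}, {f : H ↪g G // Set.range f = s} :=
          { toFun := fun f => ⟨⟨Set.range f, inducesCopy_iff_exists_embedding.2 ⟨f, rfl⟩⟩, f, rfl⟩
            invFun := fun t => t.2.1
            left_inv := fun _ => rfl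
            right_inv := by
              rintro ⟨⟨s, hs⟩, f, hf⟩
              dsimp only at hf
              subst hf
              rfl }
      _ ≃ Σ _ : {s | InducesCopy G H s}, (H ≃g H) :=
          Equiv.sigmaCongrRight fun s =>
            (embeddingRangeEquiv s.1).trans (RelIso.relIsoCongr (RelIso.refl _) s.2.some)
      _ ≃ {s | InducesCopy G H s} × (H ≃g H) := Equiv.sigmaEquivProd _ _
  rw [Nat.card_congr e, Nat.card_prod, inducedCount, Nat.card_coe_set_eq]

theorem card_aut_eq_card_perm [Fintype W] [DecidableEq W] [DecidableRel H.Adj] :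
    Nat.card (H ≃g H) =
      Fintype.card {σ : Equiv.Perm W // ∀ a b, H.Adj (σ a) (σ b) ↔ H.Adj a b} := by
  rw [← Nat.card_eq_fintype_card]
  exact Nat.card_congr
    { toFun := fun e => ⟨e.toEquiv, fun _ _ => e.map_rel_iff⟩
      invFun := fun σ => ⟨σ.1, σ.2 _ _⟩ }

theorem adj_map_iff_of_lt [LinearOrder W] {f : W → V}
    (hf : ∀ a b, a < b → (G.Adj (f a) (f b) ↔ H.Adj a b)) (a b : W) :
    G.Adj (f a) (f b) ↔ H.Adj a b := by
  rcases lt_trichotomy a b with hab | rfl | hba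
  · exact hf a b hab
  · exact iff_of_false G.irrefl H.irrefl
  · rw [G.adj_comm, H.adj_comm, hf b a hba]

/-- A map that preserves and reflects adjacency is an embedding if no two vertices of its domain
have the same neighbours. -/
def embeddingOfTwinFree [LinearOrder W] (hH : ∀ a b, (∀ c, H.Adj a c ↔ H.Adj b c) → a = b)
    (f : W → V) (hf : ∀ a b, a < b → (G.Adj (f a) (f b) ↔ H.Adj a b)) : H ↪g G where
  toFun := f
  inj' a b hab := hH a b fun c => by rw [← adj_map_iff_of_lt hf, ← adj_map_iff_of_lt hf, hab]
  map_rel_iff' := adj_map_iff_of_lt hf _ _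

end InducedCopies

theorem card_aut_cycleGraph_six :
    Nat.card (SimpleGraph.cycleGraph 6 ≃g SimpleGraph.cycleGraph 6) = 12 := by
  rw [card_aut_eq_card_perm]
  decide +kernel

instance doublyLinkedTrianglesDecidableAdj : DecidableRel doublyLinkedTriangles.Adj := fun a b => by
  unfold doublyLinkedTriangles
  infer_instance

theorem card_aut_doublyLinkedTriangles :
    Nat.card (doublyLinkedTriangles ≃g doublyLinkedTriangles) = 4 := by
  rw [card_aut_eq_card_perm]
  decide +kernel

section LocalStructure

variable {V : Type*} {G : SimpleGraph V}

theorem inducesCopy_cycleGraph_three {u v w : V} (huv : G.Adj u v) (huw : G.Adj u w)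
    (hvw : G.Adj v w) : InducesCopy G (SimpleGraph.cycleGraph 3) {u, v, w} := by
  refine inducesCopy_iff_exists_embedding.2
    ⟨embeddingOfTwinFree (by decide) ![u, v, w] fun a b hab => ?_, ?_⟩
  · fin_cases a <;> fin_cases b <;>
      first | exact absurd hab (by decide) | exact iff_of_true ‹_› (by decide)
  · change Set.range ![u, v, w] = _
    simp only [Matrix.range_cons, Matrix.range_empty, Set.union_empty, Set.singleton_union]

theorem inducesCopy_cycleGraph_four {u v a b : V} (huv : Gᶜ.Adj u v) (hab : Gᶜ.Adj a b)
    (hua : G.Adj u a) (hva : G.Adj v a) (hub : G.Adj u b) (hvb : G.Adj v b) :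
    InducesCopy G (SimpleGraph.cycleGraph 4) {u, a, v, b} := by
  have hadj (i j : Fin 4) (hij : i < j) :
      ![u, a, v, b] i ≠ ![u, a, v, b] j ∧
        (G.Adj (![u, a, v, b] i) (![u, a, v, b] j) ↔ (SimpleGraph.cycleGraph 4).Adj i j) := by
    have hav := hva.symm
    fin_cases i <;> fin_cases j <;>
      first
        | exact absurd hij (by decide)
        | exact ⟨SimpleGraph.Adj.ne ‹_›, iff_of_true ‹_› (by decide)⟩
        | exact ⟨huv.1, iff_of_false huv.2 (by decide)⟩
        | exact ⟨hab.1, iff_of_false hab.2 (by decide)⟩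
  have hinj : Function.Injective ![u, a, v, b] :=
    Function.Injective.of_lt_imp_ne fun i j hij => (hadj i j hij).1
  refine inducesCopy_iff_exists_embedding.2
    ⟨⟨⟨![u, a, v, b], hinj⟩, adj_map_iff_of_lt (fun i j hij => (hadj i j hij).2) _ _⟩, ?_⟩
  change Set.range ![u, a, v, b] = _
  simp only [Matrix.range_cons, Matrix.range_empty, Set.union_empty, Set.singleton_union]

theorem EdgesInUniqueTriangle.existsUnique_common (hI : EdgesInUniqueTriangle G) {u v : V}
    (huv : G.Adj u v) : ∃! w, G.Adj u w ∧ G.Adj v w := by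
  obtain ⟨s, ⟨hu, hv, hs⟩, huniq⟩ := hI u v huv
  have heq {w : V} (hw : G.Adj u w ∧ G.Adj v w) : {u, v, w} = s :=
    huniq _ ⟨by simp, by simp, inducesCopy_cycleGraph_three huv hw.1 hw.2⟩
  have hthird {i j : Fin 3} : (SimpleGraph.cycleGraph 3).Adj i j →
      ∃ l, (SimpleGraph.cycleGraph 3).Adj i l ∧ (SimpleGraph.cycleGraph 3).Adj j l := by
    decide +revert
  obtain ⟨f, hf⟩ := inducesCopy_iff_exists_embedding.1 hs
  obtain ⟨i, rfl⟩ := hf.ge hu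
  obtain ⟨j, rfl⟩ := hf.ge hv
  obtain ⟨l, hil, hjl⟩ := hthird (f.map_rel_iff.1 huv)
  refine ⟨f l, ⟨f.map_rel_iff.2 hil, f.map_rel_iff.2 hjl⟩, fun w hw => ?_⟩
  have hmem : w ∈ ({f i, f j, f l} : Set V) := by
    rw [heq ⟨f.map_rel_iff.2 hil, f.map_rel_iff.2 hjl⟩, ← heq hw]
    simp
  exact (hmem.resolve_left hw.1.ne').resolve_left hw.2.ne'

theorem NonEdgesInUniqueQuadrilateral.exists_common (hII : NonEdgesInUniqueQuadrilateral G)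
    {u v : V} (huv : Gᶜ.Adj u v) :
    ∃ a b, a ≠ b ∧ (G.Adj u a ∧ G.Adj v a) ∧ G.Adj u b ∧ G.Adj v b := by
  obtain ⟨s, ⟨hu, hv, hs⟩, -⟩ := hII u v huv.1 huv.2
  obtain ⟨f, rfl⟩ := inducesCopy_iff_exists_embedding.1 hs
  obtain ⟨i, rfl⟩ := hu
  obtain ⟨j, rfl⟩ := hv
  have hopposite {i j : Fin 4} : i ≠ j → ¬ (SimpleGraph.cycleGraph 4).Adj i j →
      ∃ a b, a ≠ b ∧ ((SimpleGraph.cycleGraph 4).Adj i a ∧ (SimpleGraph.cycleGraph 4).Adj j a) ∧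
        (SimpleGraph.cycleGraph 4).Adj i b ∧ (SimpleGraph.cycleGraph 4).Adj j b := by
    decide +revert
  obtain ⟨a, b, hab, ⟨hia, hja⟩, hib, hjb⟩ :=
    hopposite (ne_of_apply_ne f huv.1) fun hij => huv.2 (f.map_rel_iff.2 hij)
  exact ⟨f a, f b, f.injective.ne hab, ⟨f.map_rel_iff.2 hia, f.map_rel_iff.2 hja⟩,
    f.map_rel_iff.2 hib, f.map_rel_iff.2 hjb⟩

theorem NonEdgesInUniqueQuadrilateral.common_eq_or (hI : EdgesInUniqueTriangle G)
    (hII : NonEdgesInUniqueQuadrilateral G) {u v a b c : V} (huv : Gᶜ.Adj u v) (hab : a ≠ b)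
    (ha : G.Adj u a ∧ G.Adj v a) (hb : G.Adj u b ∧ G.Adj v b) (hc : G.Adj u c ∧ G.Adj v c) :
    c = a ∨ c = b := by
  by_contra! hne
  have hnot_adj {x : V} (hx : G.Adj u x ∧ G.Adj v x) : ¬ G.Adj a x := fun hax =>
    huv.1 ((hI.existsUnique_common hax).unique ⟨ha.1.symm, hx.1.symm⟩ ⟨ha.2.symm, hx.2.symm⟩)
  have hquad {x : V} (hx : G.Adj u x ∧ G.Adj v x) (hax : a ≠ x) :
      InducesCopy G (SimpleGraph.cycleGraph 4) {u, a, v, x} :=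
    inducesCopy_cycleGraph_four huv ⟨hax, hnot_adj hx⟩ ha.1 ha.2 hx.1 hx.2
  have hsets : ({u, a, v, b} : Set V) = {u, a, v, c} := (hII u v huv.1 huv.2).unique
    ⟨by simp, by simp, hquad hb hab⟩ ⟨by simp, by simp, hquad hc hne.1.symm⟩
  have hmem : c ∈ ({u, a, v, b} : Set V) := by simp [hsets]
  rcases hmem with hcu | hca | hcv | hcb
  exacts [hc.1.ne' hcu, hne.1 hca, hc.2.ne' hcv, hne.2 hcb]

end LocalStructure

section Regularity

variable {V : Type*} [Fintype V] {G : SimpleGraph V} [DecidableRel G.Adj] {ℓ μ : ℕ}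

theorem adjMatrix_mul_self_apply (G : SimpleGraph V) [DecidableRel G.Adj] (R : Type*)
    [NonAssocSemiring R] (u v : V) :
    (G.adjMatrix R * G.adjMatrix R) u v = Fintype.card (G.commonNeighbors u v) := by
  rw [SimpleGraph.adjMatrix_mul_apply]
  simp only [SimpleGraph.adjMatrix_apply, Finset.sum_boole]
  rw [← Set.toFinset_card]
  congr 2
  ext w
  simp only [Finset.mem_filter, SimpleGraph.mem_neighborFinset, Set.mem_toFinset,
    SimpleGraph.mem_commonNeighbors, G.adj_comm w v]

theorem adjMatrix_mul_self_eq [DecidableEq V]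
    (hadj : ∀ u v, G.Adj u v → Fintype.card (G.commonNeighbors u v) = ℓ)
    (hnadj : Pairwise fun u v => ¬ G.Adj u v → Fintype.card (G.commonNeighbors u v) = μ) :
    G.adjMatrix ℤ * G.adjMatrix ℤ = Matrix.diagonal (fun w => (G.degree w : ℤ) - μ) +
      ((ℓ : ℤ) - μ) • G.adjMatrix ℤ + Matrix.of fun _ _ => (μ : ℤ) := by
  ext u v
  rw [adjMatrix_mul_self_apply]
  rcases eq_or_ne u v with rfl | hne
  · simp only [SimpleGraph.commonNeighbors, Set.inter_self, SimpleGraph.card_neighborSet_eq_degree]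
    simp [-zsmul_eq_mul]
  · by_cases huv : G.Adj u v
    · simp [hadj u v huv, huv, hne, -zsmul_eq_mul]
    · simp [hnadj hne huv, huv, hne, -zsmul_eq_mul]

/-- Comparing entries of `A * A ^ 2 = A ^ 2 * A` for the adjacency matrix `A`. -/
theorem degree_eq_of_card_commonNeighbors (hμ : 2 ≤ μ)
    (hadj : ∀ u v, G.Adj u v → Fintype.card (G.commonNeighbors u v) = ℓ)
    (hnadj : Pairwise fun u v => ¬ G.Adj u v → Fintype.card (G.commonNeighbors u v) = μ)
    (u v : V) : G.degree u = G.degree v := by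
  classical
  have hcomm := congrFun (congrFun (mul_assoc (G.adjMatrix ℤ) (G.adjMatrix ℤ) (G.adjMatrix ℤ)) u) v
  rw [adjMatrix_mul_self_eq hadj hnadj] at hcomm
  have hleft : ((Matrix.of fun _ _ => (μ : ℤ) : Matrix V V ℤ) * G.adjMatrix ℤ) u v =
      G.degree v * μ := by
    simp [SimpleGraph.mul_adjMatrix_apply]
  have hright : (G.adjMatrix ℤ * (Matrix.of fun _ _ => (μ : ℤ) : Matrix V V ℤ)) u v =
      G.degree u * μ := by
    simp [SimpleGraph.adjMatrix_mul_apply]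
  simp only [Matrix.add_mul, Matrix.mul_add, Matrix.add_apply, hleft, hright,
    Matrix.diagonal_mul, Matrix.mul_diagonal, Matrix.smul_mul, Matrix.mul_smul,
    SimpleGraph.adjMatrix_apply] at hcomm
  have hμ' : (2 : ℤ) ≤ μ := by exact_mod_cast hμ
  by_cases huv : G.Adj u v
  · rw [if_pos huv] at hcomm
    have hmul : ((μ : ℤ) - 1) * G.degree u = (μ - 1) * G.degree v := by linear_combination -hcomm
    exact_mod_cast mul_left_cancel₀ (by lia) hmul
  · rw [if_neg huv] at hcomm
    have hmul : (μ : ℤ) * G.degree u = μ * G.degree v := by linear_combination -hcomm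
    exact_mod_cast mul_left_cancel₀ (by lia) hmul

theorem exists_isSRGWith (hI : EdgesInUniqueTriangle G) (hII : NonEdgesInUniqueQuadrilateral G) :
    ∃ k, G.IsSRGWith (Fintype.card V) k 1 2 := by
  have hadj (u v : V) (huv : G.Adj u v) : Fintype.card (G.commonNeighbors u v) = 1 := by
    obtain ⟨w, hw, huniq⟩ := hI.existsUnique_common huv
    exact Fintype.card_eq_one_iff.2 ⟨⟨w, hw⟩, fun w' => Subtype.ext (huniq w' w'.2)⟩
  have hnadj : Pairwise fun u v => ¬ G.Adj u v → Fintype.card (G.commonNeighbors u v) = 2 := by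
    intro u v hne huv
    obtain ⟨a, b, hab, ha, hb⟩ := hII.exists_common ⟨hne, huv⟩
    have hpair : G.commonNeighbors u v = {a, b} := by
      refine Set.Subset.antisymm
        (fun c hc => hII.common_eq_or hI ⟨hne, huv⟩ hab ha hb hc) ?_
      rintro c (rfl | rfl)
      exacts [ha, hb]
    rw [← Nat.card_eq_fintype_card, hpair, Nat.card_coe_set_eq, Set.ncard_pair hab]
  obtain ⟨k, hk⟩ : ∃ k, G.IsRegularOfDegree k := by
    cases isEmpty_or_nonempty V with
    | inl h => exact ⟨0, fun v => h.elim v⟩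
    | inr h => exact ⟨G.degree h.some,
        fun v => degree_eq_of_card_commonNeighbors le_rfl hadj hnadj v _⟩
  exact ⟨k, rfl, hk, hadj, hnadj⟩

end Regularity

section Counting

variable {α β γ : Type*}

theorem ncard_eq_sum_ncard_fiber [Fintype α] [Finite β] (e : γ ≃ α × β) (S : Set γ) :
    S.ncard = ∑ a, {b | e.symm (a, b) ∈ S}.ncard := by
  have e' : S ≃ Σ a, {b | e.symm (a, b) ∈ S} :=
    { toFun := fun s => ⟨(e s).1, (e s).2, by simp⟩
      invFun := fun t => ⟨e.symm (t.1, t.2.1), t.2.2⟩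
      left_inv := fun s => by simp
      right_inv := fun t => by
        obtain ⟨a, b, hb⟩ := t
        ext <;> simp }
  rw [← Nat.card_coe_set_eq, Nat.card_congr e', Nat.card_sigma]
  simp only [Nat.card_coe_set_eq]

theorem sum_ite_mem_eq_ncard_mul [Fintype α] (T : Set α) [DecidablePred (· ∈ T)] (c : ℤ) :
    ∑ a, (if a ∈ T then c else 0) = T.ncard * c := by
  classical
  rw [← Finset.sum_filter, Finset.sum_const, nsmul_eq_mul, Set.ncard_eq_toFinset_card',
    ← Set.filter_mem_univ_eq_toFinset]

theorem cast_ncard_eq_mul_of_fiber [Finite α] [Finite β] (e : γ ≃ α × β) {S : Set γ} {T : Set α}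
    {c : ℤ} (hST : ∀ s ∈ S, (e s).1 ∈ T)
    (hfiber : ∀ a ∈ T, ({b | e.symm (a, b) ∈ S}.ncard : ℤ) = c) :
    (S.ncard : ℤ) = T.ncard * c := by
  classical
  have := Fintype.ofFinite α
  have hterm (a : α) : ({b | e.symm (a, b) ∈ S}.ncard : ℤ) = if a ∈ T then c else 0 := by
    split_ifs with ha
    · exact hfiber a ha
    · have hempty : {b | e.symm (a, b) ∈ S} = ∅ :=
        Set.eq_empty_of_forall_notMem fun b hb => ha (by simpa using hST _ hb)
      rw [hempty, Set.ncard_empty, Nat.cast_zero]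
  rw [ncard_eq_sum_ncard_fiber e, Nat.cast_sum, ← sum_ite_mem_eq_ncard_mul]
  exact Finset.sum_congr rfl fun a _ => hterm a

theorem ncard_and_add_ncard_and_not [Finite α] (P Q : α → Prop) :
    {a | P a ∧ Q a}.ncard + {a | P a ∧ ¬ Q a}.ncard = {a | P a}.ncard :=
  Set.ncard_inter_add_ncard_sdiff_eq_ncard {a | P a} {a | Q a}

theorem ncard_and_and_not_comm [Finite α] {P A B : α → Prop}
    (hAB : {a | P a ∧ A a}.ncard = {a | P a ∧ B a}.ncard) :
    {a | (P a ∧ A a) ∧ ¬ B a}.ncard = {a | (P a ∧ B a) ∧ ¬ A a}.ncard := by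
  have hA := ncard_and_add_ncard_and_not (fun a => P a ∧ A a) B
  have hB := ncard_and_add_ncard_and_not (fun a => P a ∧ B a) A
  have hcomm : {a | (P a ∧ A a) ∧ B a} = {a | (P a ∧ B a) ∧ A a} :=
    Set.ext fun _ => and_right_comm
  rw [hcomm] at hA
  lia

theorem cast_ncard_and_not_and_not_and_not [Finite α] (P A B C : α → Prop)
    (h : ∀ a, P a → A a → B a → ¬ C a) :
    ({a | P a ∧ ¬ A a ∧ ¬ B a ∧ ¬ C a}.ncard : ℤ) =
      {a | P a}.ncard - {a | P a ∧ A a}.ncard - {a | P a ∧ B a}.ncard - {a | P a ∧ C a}.ncard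
        + {a | P a ∧ A a ∧ B a}.ncard + {a | P a ∧ B a ∧ C a}.ncard
        + {a | P a ∧ C a ∧ A a}.ncard := by
  classical
  have := Fintype.ofFinite α
  simp only [Set.ncard_eq_toFinset_card', Set.toFinset_ofPred, Finset.card_filter, Nat.cast_sum,
    ← Finset.sum_sub_distrib, ← Finset.sum_add_distrib]
  refine Finset.sum_congr rfl fun a _ => ?_
  have := h a
  by_cases hP : P a <;> by_cases hA : A a <;> by_cases hB : B a <;> by_cases hC : C a <;>
    simp_all

end Counting

section Configurations

variable {V : Type*} {G : SimpleGraph V}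

/-- A cherry: two distinct non-adjacent vertices `q` and `x` with a common neighbour `p`. -/
def IsCherry (G : SimpleGraph V) (p q x : V) : Prop :=
  G.Adj p q ∧ G.Adj p x ∧ Gᶜ.Adj q x

/-- Three distinct pairwise non-adjacent vertices. -/
def IsIndepTriple (G : SimpleGraph V) (x y z : V) : Prop :=
  Gᶜ.Adj x y ∧ Gᶜ.Adj y z ∧ Gᶜ.Adj z x

theorem IsCherry.symm {p q x : V} (h : IsCherry G p q x) :
    IsCherry G p x q :=
  ⟨h.2.1, h.1, h.2.2.symm⟩

/-- A claw: three distinct pairwise non-adjacent vertices with a common neighbour `w`. -/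
def IsClaw (G : SimpleGraph V) (w x y z : V) : Prop :=
  IsCherry G w x y ∧ IsCherry G w y z ∧ IsCherry G w z x

theorem isClaw_iff_of_isIndepTriple {w x y z : V} (ht : IsIndepTriple G x y z) :
    IsClaw G w x y z ↔ G.Adj x w ∧ G.Adj y w ∧ G.Adj z w := by
  simp only [IsClaw, IsCherry, ht.1, ht.2.1, ht.2.2, G.adj_comm w]
  tauto

/-- A hexagon `x p y q z r` that may have chords among `p`, `q`, `r`: each of these is adjacent
to exactly two of the three vertices of the independent triple `x`, `y`, `z`. -/
def IsHexFrame (G : SimpleGraph V) (x y z p q r : V) : Prop :=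
  IsIndepTriple G x y z ∧ (G.Adj x p ∧ G.Adj y p ∧ ¬ G.Adj z p) ∧
    (G.Adj y q ∧ G.Adj z q ∧ ¬ G.Adj x q) ∧ G.Adj z r ∧ G.Adj x r ∧ ¬ G.Adj y r

/-- A triangle `p q y` with a handle, that is, a path `p x r z q` leaving the triangle at `p` and
re-entering it at `q`. -/
def IsHandledTriangle (G : SimpleGraph V) (p q y x z r : V) : Prop :=
  (G.Adj p q ∧ G.Adj p y ∧ G.Adj q y) ∧ IsCherry G p q x ∧ IsCherry G q p z ∧
    G.Adj x r ∧ G.Adj z r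

theorem IsHandledTriangle.symm {p q y x z r : V} (h : IsHandledTriangle G p q y x z r) :
    IsHandledTriangle G q p y z x r :=
  ⟨⟨h.1.1.symm, h.1.2.2, h.1.2.1⟩, h.2.2.1, h.2.1, h.2.2.2.2, h.2.2.2.1⟩

theorem IsHandledTriangle.handle_ne_tip {p q y x z r : V}
    (ht : IsHandledTriangle G p q y x z r) : x ≠ y := by
  rintro rfl
  exact ht.2.1.2.2.2 ht.1.2.2

theorem IsIndepTriple.rotate {x y z : V} (ht : IsIndepTriple G x y z) : IsIndepTriple G y z x :=
  ⟨ht.2.1, ht.2.2, ht.1⟩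

theorem IsHexFrame.rotate {x y z p q r : V} (hf : IsHexFrame G x y z p q r) :
    IsHexFrame G y z x q r p :=
  ⟨hf.1.rotate, hf.2.2.1, hf.2.2.2, hf.2.1⟩

theorem ncard_isHexFrame_rotate (G : SimpleGraph V) (P : V → V → V → Prop) :
    ({((x, y, z), p, q, r) | IsHexFrame G x y z p q r ∧ P p q r} :
      Set ((V × V × V) × V × V × V)).ncard =
    ({((x, y, z), p, q, r) | IsHexFrame G x y z p q r ∧ P r p q} :
      Set ((V × V × V) × V × V × V)).ncard :=
  Set.ncard_congr'
    { toFun := fun t => ⟨((t.1.1.2.1, t.1.1.2.2, t.1.1.1), t.1.2.2.1, t.1.2.2.2, t.1.2.1),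
        t.2.1.rotate, t.2.2⟩
      invFun := fun t => ⟨((t.1.1.2.2, t.1.1.1, t.1.1.2.1), t.1.2.2.2, t.1.2.1, t.1.2.2.1),
        t.2.1.rotate.rotate, t.2.2⟩ }

end Configurations

section InducedConfigurations

variable {V : Type*} {G : SimpleGraph V}

theorem isHexFrame_of_embedding (f : SimpleGraph.cycleGraph 6 ↪g G) :
    IsHexFrame G (f 0) (f 2) (f 4) (f 1) (f 3) (f 5) ∧ ¬ G.Adj (f 1) (f 3) ∧
      ¬ G.Adj (f 3) (f 5) ∧ ¬ G.Adj (f 5) (f 1) := by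
  simp only [IsHexFrame, IsIndepTriple, SimpleGraph.compl_adj, f.map_adj_iff, f.injective.ne_iff]
  decide

theorem isHandledTriangle_of_embedding (f : doublyLinkedTriangles ↪g G) :
    (IsHandledTriangle G (f 0) (f 1) (f 2) (f 3) (f 4) (f 5) ∧ G.Adj (f 3) (f 4)) ∧
      ¬ G.Adj (f 2) (f 5) := by
  simp only [IsHandledTriangle, IsCherry, SimpleGraph.compl_adj, f.map_adj_iff,
    f.injective.ne_iff]
  decide

theorem cycleGraph_six_adj_iff_of_isHexFrame {x y z p q r : V}
    (hf : IsHexFrame G x y z p q r ∧ ¬ G.Adj p q ∧ ¬ G.Adj q r ∧ ¬ G.Adj r p) (a b : Fin 6)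
    (hab : a < b) : G.Adj (![x, p, y, q, z, r] a) (![x, p, y, q, z, r] b) ↔
      (SimpleGraph.cycleGraph 6).Adj a b := by
  obtain ⟨⟨⟨⟨-, hxy⟩, ⟨-, hyz⟩, -, hzx⟩, ⟨hxp, hyp, hzp⟩, ⟨hyq, hzq, hxq⟩, hzr, hxr, hyr⟩,
    hpq, hqr, hrp⟩ := hf
  rw [G.adj_comm] at hyp hzp hzq hzx hrp
  fin_cases a <;> fin_cases b <;>
    first
      | exact absurd hab (by decide)
      | exact iff_of_true ‹_› (by decide)
      | exact iff_of_false ‹_› (by decide)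

theorem inducedCount_cycleGraph_six_mul_twelve [Finite V] :
    inducedCount G (SimpleGraph.cycleGraph 6) * 12 =
      ({((x, y, z), p, q, r) | IsHexFrame G x y z p q r ∧
        ¬ G.Adj p q ∧ ¬ G.Adj q r ∧ ¬ G.Adj r p} : Set ((V × V × V) × V × V × V)).ncard := by
  rw [← card_aut_cycleGraph_six, ← card_embedding_eq_inducedCount_mul_card_aut,
    ← Nat.card_coe_set_eq]
  exact Nat.card_congr
    { toFun := fun f => ⟨((f 0, f 2, f 4), f 1, f 3, f 5), isHexFrame_of_embedding f⟩
      invFun := fun ⟨((x, y, z), p, q, r), hf⟩ =>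
        embeddingOfTwinFree (by decide) ![x, p, y, q, z, r]
          (cycleGraph_six_adj_iff_of_isHexFrame hf)
      left_inv := fun f => by
        ext a
        fin_cases a <;> rfl
      right_inv := fun _ => rfl }

end InducedConfigurations

section StronglyRegular

theorem ncard_and_adj_add_ncard_and_compl_adj {V : Type*} [Finite V] (G : SimpleGraph V)
    {P : V → Prop} {v : V} (hv : P v) :
    {w | P w ∧ G.Adj v w}.ncard + {w | P w ∧ Gᶜ.Adj v w}.ncard + 1 = {w | P w}.ncard := by
  have hinsert : {w | P w ∧ ¬ G.Adj v w} = insert v {w | P w ∧ Gᶜ.Adj v w} := by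
    ext w
    simp only [SimpleGraph.compl_adj, Set.mem_ofPred_eq, Set.mem_insert_iff]
    have := G.irrefl (v := v)
    grind
  rw [← ncard_and_add_ncard_and_not P (G.Adj v), hinsert,
    Set.ncard_insert_of_notMem fun hmem => Gᶜ.irrefl hmem.2, add_assoc]

variable {V : Type*} [Fintype V] {G : SimpleGraph V} [DecidableRel G.Adj] {n k ℓ μ : ℕ}

theorem ncard_adj (h : G.IsSRGWith n k ℓ μ) (u : V) : {v | G.Adj u v}.ncard = k := by
  rw [← h.regular u, ← G.card_neighborSet_eq_degree, ← Nat.card_eq_fintype_card,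
    Nat.card_coe_set_eq]
  rfl

theorem ncard_common_of_adj (h : G.IsSRGWith n k ℓ μ) {u v : V} (huv : G.Adj u v) :
    {w | G.Adj u w ∧ G.Adj v w}.ncard = ℓ := by
  rw [← h.of_adj u v huv, ← Nat.card_eq_fintype_card, Nat.card_coe_set_eq]
  rfl

theorem ncard_common_of_not_adj (h : G.IsSRGWith n k ℓ μ) {u v : V} (hne : u ≠ v)
    (huv : ¬ G.Adj u v) : {w | G.Adj u w ∧ G.Adj v w}.ncard = μ := by
  rw [← h.of_not_adj hne huv, ← Nat.card_eq_fintype_card, Nat.card_coe_set_eq]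
  rfl

theorem existsUnique_common_of_adj (h : G.IsSRGWith n k 1 μ) {u v : V} (huv : G.Adj u v) :
    ∃! w, G.Adj u w ∧ G.Adj v w := by
  obtain ⟨w, hw⟩ := Set.ncard_eq_one.1 (ncard_common_of_adj h huv)
  exact ⟨w, hw.ge rfl, fun w' hw' => hw.le hw'⟩

theorem common_unique_of_adj (h : G.IsSRGWith n k 1 μ) {u v w w' : V} (huv : G.Adj u v)
    (huw : G.Adj u w) (hvw : G.Adj v w) (huw' : G.Adj u w') (hvw' : G.Adj v w') : w = w' :=
  (existsUnique_common_of_adj h huv).unique ⟨huw, hvw⟩ ⟨huw', hvw'⟩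

theorem existsUnique_common_ne_of_not_adj (h : G.IsSRGWith n k ℓ 2) {u v a : V} (hne : u ≠ v)
    (huv : ¬ G.Adj u v) (hua : G.Adj u a) (hva : G.Adj v a) :
    ∃! b, b ≠ a ∧ G.Adj u b ∧ G.Adj v b := by
  have hone : ({w | G.Adj u w ∧ G.Adj v w} \ {a}).ncard = 1 := by
    have ha : a ∈ {w | G.Adj u w ∧ G.Adj v w} := ⟨hua, hva⟩
    rw [Set.ncard_sdiff_singleton_of_mem ha, ncard_common_of_not_adj h hne huv]
  obtain ⟨b, hb⟩ := Set.ncard_eq_one.1 hone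
  obtain ⟨hub, hba⟩ := hb.ge rfl
  exact ⟨b, ⟨hba, hub⟩, fun c ⟨hca, huc⟩ => hb.le ⟨huc, hca⟩⟩

theorem cast_ncard_isCherry_of_adj (h : G.IsSRGWith n k ℓ μ) {p q : V} (hpq : G.Adj p q) :
    ({x | IsCherry G p q x}.ncard : ℤ) = k - ℓ - 1 := by
  have hsplit := ncard_and_adj_add_ncard_and_compl_adj G (P := G.Adj p) hpq
  rw [ncard_common_of_adj h hpq, ncard_adj h] at hsplit
  have hcherry : {x | IsCherry G p q x} = {x | G.Adj p x ∧ Gᶜ.Adj q x} := by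
    simp only [IsCherry, hpq, true_and]
  rw [hcherry]
  lia

theorem cast_ncard_compl_adj (h : G.IsSRGWith n k ℓ μ) (x : V) :
    ({y | Gᶜ.Adj x y}.ncard : ℤ) = n - k - 1 := by
  have hsplit := ncard_and_adj_add_ncard_and_compl_adj G (P := fun _ => True) (v := x) trivial
  simp only [true_and, ncard_adj h, Set.ofPred_true, Set.ncard_univ, Nat.card_eq_fintype_card,
    h.card] at hsplit
  lia

theorem cast_ncard_isIndepTriple_of_compl_adj (h : G.IsSRGWith n k ℓ μ) {x y : V}
    (hxy : Gᶜ.Adj x y) : ({z | IsIndepTriple G x y z}.ncard : ℤ) = n - 2 * k + μ - 2 := by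
  have hcompl := ncard_and_adj_add_ncard_and_compl_adj G (P := Gᶜ.Adj x) hxy
  have hnbr := ncard_and_add_ncard_and_not (G.Adj y) (G.Adj x)
  have hx := cast_ncard_compl_adj h x
  have hcommon : {z | G.Adj y z ∧ G.Adj x z}.ncard = μ :=
    ncard_common_of_not_adj h hxy.ne' fun hyx => hxy.2 hyx.symm
  have hswap : {z | Gᶜ.Adj x z ∧ G.Adj y z} = {z | G.Adj y z ∧ ¬ G.Adj x z} := by
    ext z
    simp only [SimpleGraph.compl_adj, Set.mem_ofPred_eq]
    grind [SimpleGraph.compl_adj, SimpleGraph.adj_comm]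
  have htriple : {z | IsIndepTriple G x y z} = {z | Gᶜ.Adj x z ∧ Gᶜ.Adj y z} := by
    ext z
    simp only [IsIndepTriple, Set.mem_ofPred_eq, hxy, Gᶜ.adj_comm z x]
    tauto
  rw [ncard_adj h, hcommon] at hnbr
  rw [hswap] at hcompl
  rw [htriple]
  lia

theorem cast_ncard_adj_pairs (h : G.IsSRGWith n k ℓ μ) :
    ({(p, q) | G.Adj p q} : Set (V × V)).ncard = (n * k : ℤ) :=
  calc (({(p, q) | G.Adj p q} : Set (V × V)).ncard : ℤ)
    _ = (Set.univ : Set V).ncard * k :=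
        cast_ncard_eq_mul_of_fiber (Equiv.refl _) (fun _ _ => Set.mem_univ _)
          fun p _ => congrArg _ (ncard_adj h p)
    _ = n * k := by rw [Set.ncard_univ, Nat.card_eq_fintype_card, h.card]

theorem cast_ncard_compl_adj_pairs (h : G.IsSRGWith n k ℓ μ) :
    ({(x, y) | Gᶜ.Adj x y} : Set (V × V)).ncard = (n * (n - k - 1) : ℤ) :=
  calc (({(x, y) | Gᶜ.Adj x y} : Set (V × V)).ncard : ℤ)
    _ = (Set.univ : Set V).ncard * (n - k - 1) :=
        cast_ncard_eq_mul_of_fiber (Equiv.refl _) (fun _ _ => Set.mem_univ _)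
          fun x _ => cast_ncard_compl_adj h x
    _ = n * (n - k - 1) := by rw [Set.ncard_univ, Nat.card_eq_fintype_card, h.card]

theorem cast_ncard_isCherry (h : G.IsSRGWith n k ℓ μ) :
    ({(p, q, x) | IsCherry G p q x} : Set (V × V × V)).ncard = (n * k * (k - ℓ - 1) : ℤ) :=
  calc (({(p, q, x) | IsCherry G p q x} : Set (V × V × V)).ncard : ℤ)
    _ = ({(p, q) | G.Adj p q} : Set (V × V)).ncard * (k - ℓ - 1) :=
        cast_ncard_eq_mul_of_fiber (Equiv.prodAssoc V V V).symm (fun _ hc => hc.1)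
          fun (_, _) hpq => cast_ncard_isCherry_of_adj h hpq
    _ = n * k * (k - ℓ - 1) := by rw [cast_ncard_adj_pairs h]

theorem mul_compl_degree_mul_eq (h : G.IsSRGWith n k ℓ μ) :
    (n * (n - k - 1) * μ : ℤ) = n * k * (k - ℓ - 1) := by
  have hcommon {q x : V} (hqx : Gᶜ.Adj q x) : ({p | IsCherry G p q x}.ncard : ℤ) = μ := by
    rw [← ncard_common_of_not_adj h hqx.1 hqx.2]
    simp only [IsCherry, hqx, and_true, G.adj_comm]
  calc (n * (n - k - 1) * μ : ℤ)
    _ = ({(q, x) | Gᶜ.Adj q x} : Set (V × V)).ncard * μ := by rw [cast_ncard_compl_adj_pairs h]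
    _ = ({(p, q, x) | IsCherry G p q x} : Set (V × V × V)).ncard :=
        (cast_ncard_eq_mul_of_fiber (Equiv.prodComm _ _) (fun _ hc => hc.2.2)
          fun (_, _) hqx => hcommon hqx).symm
    _ = n * k * (k - ℓ - 1) := cast_ncard_isCherry h

theorem cast_ncard_isIndepTriple (h : G.IsSRGWith n k ℓ μ) :
    ({(x, y, z) | IsIndepTriple G x y z} : Set (V × V × V)).ncard =
      (n * (n - k - 1) * (n - 2 * k + μ - 2) : ℤ) :=
  calc (({(x, y, z) | IsIndepTriple G x y z} : Set (V × V × V)).ncard : ℤ)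
    _ = ({(x, y) | Gᶜ.Adj x y} : Set (V × V)).ncard * (n - 2 * k + μ - 2) :=
        cast_ncard_eq_mul_of_fiber (Equiv.prodAssoc V V V).symm (fun _ ht => ht.1)
          fun (_, _) hxy => cast_ncard_isIndepTriple_of_compl_adj h hxy
    _ = n * (n - k - 1) * (n - 2 * k + μ - 2) := by rw [cast_ncard_compl_adj_pairs h]

theorem IsCherry.third_left (h : G.IsSRGWith n k 1 μ) {p q x y : V} (hc : IsCherry G p q x)
    (hpy : G.Adj p y) (hqy : G.Adj q y) : IsCherry G p y x := by
  obtain ⟨hpq, hpx, hqx⟩ := hc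
  refine ⟨hpy, hpx, ?_, fun hyx => hqx.1 (common_unique_of_adj h hpy hpq hqy.symm hpx hyx)⟩
  rintro rfl
  exact hqx.2 hqy

theorem IsCherry.existsUnique_opposite (h : G.IsSRGWith n k ℓ 2) {p q x : V}
    (hc : IsCherry G p q x) : ∃! z, z ≠ p ∧ G.Adj q z ∧ G.Adj x z :=
  existsUnique_common_ne_of_not_adj h hc.2.2.1 hc.2.2.2 hc.1.symm hc.2.1.symm

theorem IsCherry.opposite (h : G.IsSRGWith n k 1 μ) {p q x z : V} (hc : IsCherry G p q x)
    (hzp : z ≠ p) (hqz : G.Adj q z) (hxz : G.Adj x z) : IsCherry G q p z :=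
  ⟨hc.1.symm, hqz, hzp.symm, fun hpz =>
    hc.2.2.1 (common_unique_of_adj h hpz hc.1 hqz.symm hc.2.1 hxz.symm)⟩

theorem cast_ncard_isClaw_of_isCherry (h : G.IsSRGWith n k 1 μ) {w x y : V}
    (hc : IsCherry G w x y) : ({z | IsClaw G w x y z}.ncard : ℤ) = k - 4 := by
  have hsplit := ncard_and_adj_add_ncard_and_compl_adj G (P := IsCherry G w x) hc
  have hcherry := cast_ncard_isCherry_of_adj h hc.1
  have hthird : {z | IsCherry G w x z ∧ G.Adj y z}.ncard = 1 := by
    obtain ⟨z, ⟨hwz, hyz⟩, huniq⟩ := existsUnique_common_of_adj h hc.2.1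
    refine Set.ncard_eq_one.2 ⟨z, Set.eq_singleton_iff_unique_mem.2 ⟨⟨?_, hyz⟩, ?_⟩⟩
    · exact (hc.symm.third_left h hwz hyz).symm
    · exact fun z' hz' => huniq z' ⟨hz'.1.2.1, hz'.2⟩
  have hclaw : {z | IsClaw G w x y z} = {z | IsCherry G w x z ∧ Gᶜ.Adj y z} := by
    ext z
    simp only [IsClaw, hc, Set.mem_ofPred_eq]
    exact ⟨fun hz => ⟨hz.2.2.symm, hz.2.1.2.2⟩,
      fun hz => ⟨trivial, ⟨hc.2.1, hz.1.2.1, hz.2⟩, hz.1.symm⟩⟩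
  rw [hclaw]
  push_cast at hcherry
  lia

theorem cast_ncard_isClaw (h : G.IsSRGWith n k 1 μ) :
    ({(w, x, y, z) | IsClaw G w x y z} : Set (V × V × V × V)).ncard =
      (n * k * (k - 2) * (k - 4) : ℤ) :=
  calc (({(w, x, y, z) | IsClaw G w x y z} : Set (V × V × V × V)).ncard : ℤ)
    _ = ({(w, x, y) | IsCherry G w x y} : Set (V × V × V)).ncard * (k - 4) :=
        cast_ncard_eq_mul_of_fiber
          { toFun := fun t => ((t.1, t.2.1, t.2.2.1), t.2.2.2)
            invFun := fun t => (t.1.1, t.1.2.1, t.1.2.2, t.2) }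
          (fun _ hclaw => hclaw.1) fun (_, _, _) hc => cast_ncard_isClaw_of_isCherry h hc
    _ = n * k * (k - 2) * (k - 4) := by
        rw [cast_ncard_isCherry h]
        push_cast
        ring

theorem ncard_isClaw_le_one (h : G.IsSRGWith n k 1 2) (x y z : V) :
    {w | IsClaw G w x y z}.ncard ≤ 1 := by
  refine (Set.ncard_le_one_iff (Set.toFinite _)).2 fun {w w'} hw hw' => ?_
  by_contra hne
  obtain ⟨hxy, hyz, hzx⟩ := hw
  obtain ⟨hxy', hyz', hzx'⟩ := hw'
  by_cases hadj : G.Adj w w'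
  · exact hxy.2.2.1 (common_unique_of_adj h hadj hxy.1 hxy'.1 hyz.1 hyz'.1)
  · exact hyz.2.2.1 ((existsUnique_common_ne_of_not_adj h hne hadj hxy.1 hxy'.1).unique
      ⟨hxy.2.2.1.symm, hyz.1, hyz'.1⟩ ⟨hzx.2.2.1, hzx.1, hzx'.1⟩)

theorem cast_ncard_common_not_adj (h : G.IsSRGWith n k ℓ μ) {x y z : V}
    (ht : IsIndepTriple G x y z) :
    ({p | G.Adj x p ∧ G.Adj y p ∧ ¬ G.Adj z p}.ncard : ℤ) =
      μ - {w | IsClaw G w x y z}.ncard := by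
  have hsplit := ncard_and_add_ncard_and_not (fun p => G.Adj x p ∧ G.Adj y p) (G.Adj z)
  rw [ncard_common_of_not_adj h ht.1.1 ht.1.2] at hsplit
  simp only [isClaw_iff_of_isIndepTriple ht]
  simp only [and_assoc] at hsplit
  lia

theorem cast_ncard_isHexFrame_of_isIndepTriple (h : G.IsSRGWith n k 1 2) {x y z : V}
    (ht : IsIndepTriple G x y z) :
    ({(p, q, r) | IsHexFrame G x y z p q r} : Set (V × V × V)).ncard +
      (7 * {w | IsClaw G w x y z}.ncard : ℤ) = 8 := by
  have hprod : ({(p, q, r) | IsHexFrame G x y z p q r} : Set (V × V × V)) =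
      {p | G.Adj x p ∧ G.Adj y p ∧ ¬ G.Adj z p} ×ˢ {q | G.Adj y q ∧ G.Adj z q ∧ ¬ G.Adj x q} ×ˢ
        {r | G.Adj z r ∧ G.Adj x r ∧ ¬ G.Adj y r} := by
    ext ⟨p, q, r⟩
    simp only [IsHexFrame, ht, true_and, Set.mem_ofPred_eq, Set.mem_prod]
  have hrotate (x y z : V) : {w | IsClaw G w y z x} = {w | IsClaw G w x y z} :=
    Set.ext fun w => and_rotate.symm
  rw [hprod, Set.ncard_prod, Set.ncard_prod]
  push_cast
  rw [cast_ncard_common_not_adj h ht, cast_ncard_common_not_adj h ht.rotate,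
    cast_ncard_common_not_adj h ht.rotate.rotate, hrotate y z x, hrotate x y z]
  rcases Nat.le_one_iff_eq_zero_or_eq_one.1 (ncard_isClaw_le_one h x y z) with hclaw | hclaw <;>
    rw [hclaw] <;> norm_num

theorem cast_ncard_isHexFrame_add (h : G.IsSRGWith n k 1 2) :
    ({((x, y, z), p, q, r) | IsHexFrame G x y z p q r} : Set ((V × V × V) × V × V × V)).ncard +
      7 * ({(w, x, y, z) | IsClaw G w x y z} : Set (V × V × V × V)).ncard =
    (({(x, y, z) | IsIndepTriple G x y z} : Set (V × V × V)).ncard * 8 : ℤ) := by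
  classical
  rw [ncard_eq_sum_ncard_fiber (Equiv.refl _), ncard_eq_sum_ncard_fiber (Equiv.prodComm V _),
    ← sum_ite_mem_eq_ncard_mul, Nat.cast_sum, Nat.cast_sum, Finset.mul_sum,
    ← Finset.sum_add_distrib]
  refine Finset.sum_congr rfl fun (x, y, z) _ => ?_
  split_ifs with ht
  · exact cast_ncard_isHexFrame_of_isIndepTriple h ht
  · have hframe : ({(p, q, r) | IsHexFrame G x y z p q r} : Set (V × V × V)) = ∅ :=
      Set.eq_empty_of_forall_notMem fun _ hf => ht hf.1
    have hclaw : {w | IsClaw G w x y z} = ∅ :=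
      Set.eq_empty_of_forall_notMem fun _ hc => ht ⟨hc.1.2.2, hc.2.1.2.2, hc.2.2.2.2⟩
    change (({(p, q, r) | IsHexFrame G x y z p q r} : Set (V × V × V)).ncard : ℤ) +
      7 * {w | IsClaw G w x y z}.ncard = 0
    rw [hframe, hclaw]
    simp only [Set.ncard_empty, Nat.cast_zero, mul_zero, add_zero]

theorem IsCherry.ncard_opposite (h : G.IsSRGWith n k 1 2) {p q x : V} (hc : IsCherry G p q x) :
    {z | IsCherry G q p z ∧ G.Adj x z}.ncard = 1 := by
  obtain ⟨z, ⟨hzp, hqz, hxz⟩, huniq⟩ := hc.existsUnique_opposite h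
  refine Set.ncard_eq_one.2 ⟨z, Set.eq_singleton_iff_unique_mem.2
    ⟨⟨hc.opposite h hzp hqz hxz, hxz⟩, fun z' hz' => ?_⟩⟩
  exact huniq z' ⟨hz'.1.2.2.1.symm, hz'.1.2.1, hz'.2⟩

theorem cast_ncard_isCherry_not_adj_of_isCherry (h : G.IsSRGWith n k 1 2) {p q x : V}
    (hc : IsCherry G p q x) : ({z | IsCherry G q p z ∧ ¬ G.Adj x z}.ncard : ℤ) = k - 3 := by
  have hsplit := ncard_and_add_ncard_and_not (IsCherry G q p) (G.Adj x)
  have hcherry := cast_ncard_isCherry_of_adj h hc.1.symm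
  rw [hc.ncard_opposite h] at hsplit
  lia

theorem cast_ncard_isCherry_isCherry_not_adj (h : G.IsSRGWith n k 1 2) :
    ({(p, q, x, z) | IsCherry G p q x ∧ IsCherry G q p z ∧ ¬ G.Adj x z} :
      Set (V × V × V × V)).ncard = (n * k * (k - 2) * (k - 3) : ℤ) :=
  calc (({(p, q, x, z) | IsCherry G p q x ∧ IsCherry G q p z ∧ ¬ G.Adj x z} :
      Set (V × V × V × V)).ncard : ℤ)
    _ = ({(p, q, x) | IsCherry G p q x} : Set (V × V × V)).ncard * (k - 3) :=
        cast_ncard_eq_mul_of_fiber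
          { toFun := fun t => ((t.1, t.2.1, t.2.2.1), t.2.2.2)
            invFun := fun t => (t.1.1, t.1.2.1, t.1.2.2, t.2) }
          (fun _ ht => ht.1) fun (p, q, x) hc => by
            rw [← cast_ncard_isCherry_not_adj_of_isCherry h hc]
            exact congrArg _ (congrArg _ (Set.ext fun z => and_iff_right hc))
    _ = n * k * (k - 2) * (k - 3) := by
        rw [cast_ncard_isCherry h]
        push_cast
        ring

theorem ncard_isHandledTriangle_of_isCherry (h : G.IsSRGWith n k 1 2) {p q x z : V}
    (hx : IsCherry G p q x) (hz : IsCherry G q p z) (hxz : ¬ G.Adj x z) :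
    ({(y, r) | IsHandledTriangle G p q y x z r} : Set (V × V)).ncard = 2 := by
  have hprod : ({(y, r) | IsHandledTriangle G p q y x z r} : Set (V × V)) =
      {y | G.Adj p y ∧ G.Adj q y} ×ˢ {r | G.Adj x r ∧ G.Adj z r} := by
    ext ⟨y, r⟩
    simp only [IsHandledTriangle, hx, hz, hx.1, true_and, Set.mem_ofPred_eq, Set.mem_prod]
  have hne : x ≠ z := fun hxz => hx.2.2.2 (hxz ▸ hz.2.1)
  rw [hprod, Set.ncard_prod, ncard_common_of_adj h hx.1, ncard_common_of_not_adj h hne hxz]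

theorem cast_ncard_isHandledTriangle_not_adj (h : G.IsSRGWith n k 1 2) :
    ({(p, q, y, x, z, r) | IsHandledTriangle G p q y x z r ∧ ¬ G.Adj x z} :
      Set (V × V × V × V × V × V)).ncard = (n * k * (k - 2) * (k - 3) * 2 : ℤ) :=
  calc (({(p, q, y, x, z, r) | IsHandledTriangle G p q y x z r ∧ ¬ G.Adj x z} :
      Set (V × V × V × V × V × V)).ncard : ℤ)
    _ = ({(p, q, x, z) | IsCherry G p q x ∧ IsCherry G q p z ∧ ¬ G.Adj x z} :
          Set (V × V × V × V)).ncard * 2 :=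
        cast_ncard_eq_mul_of_fiber
          { toFun := fun t => ((t.1, t.2.1, t.2.2.2.1, t.2.2.2.2.1), t.2.2.1, t.2.2.2.2.2)
            invFun := fun t => (t.1.1, t.1.2.1, t.2.1, t.1.2.2.1, t.1.2.2.2, t.2.2) }
          (fun _ ht => ⟨ht.1.2.1, ht.1.2.2.1, ht.2⟩) fun (p, q, x, z) ⟨hx, hz, hxz⟩ => by
            rw [← Nat.cast_ofNat, ← ncard_isHandledTriangle_of_isCherry h hx hz hxz]
            exact congrArg _ (congrArg _ (Set.ext fun _ => and_iff_left hxz))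
    _ = n * k * (k - 2) * (k - 3) * 2 := by rw [cast_ncard_isCherry_isCherry_not_adj h]

theorem bijOn_isHandledTriangle_adj_handle (h : G.IsSRGWith n k 1 2) :
    Set.BijOn (fun (p, q, _, x, _, _) => (p, q, x))
      {(p, q, y, x, z, r) : V × V × V × V × V × V | IsHandledTriangle G p q y x z r ∧ G.Adj x z}
      {(p, q, x) | IsCherry G p q x} := by
  refine ⟨fun _ ht => ht.1.2.1, ?_, ?_⟩
  · rintro ⟨p, q, y, x, z, r⟩ ⟨⟨⟨_, hpy, hqy⟩, hx, hz, hxr, hzr⟩, hxz⟩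
      ⟨_, _, y', _, z', r'⟩ ⟨⟨⟨_, hpy', hqy'⟩, _, hz', hxr', hzr'⟩, hxz'⟩ heq
    obtain ⟨rfl, rfl, rfl⟩ : p = _ ∧ q = _ ∧ x = _ := by simpa only [Prod.mk.injEq] using heq
    obtain rfl := common_unique_of_adj h hx.1 hpy hqy hpy' hqy'
    obtain rfl := (hx.existsUnique_opposite h).unique ⟨hz.2.2.1.symm, hz.2.1, hxz⟩
      ⟨hz'.2.2.1.symm, hz'.2.1, hxz'⟩
    obtain rfl := common_unique_of_adj h hxz hxr hzr hxr' hzr'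
    rfl
  · rintro ⟨p, q, x⟩ hx
    obtain ⟨y, hy, -⟩ := existsUnique_common_of_adj h hx.1
    obtain ⟨z, ⟨hzp, hqz, hxz⟩, -⟩ := hx.existsUnique_opposite h
    obtain ⟨r, hr, -⟩ := existsUnique_common_of_adj h hxz
    exact ⟨(p, q, y, x, z, r), ⟨⟨⟨hx.1, hy⟩, hx, hx.opposite h hzp hqz hxz, hr⟩, hxz⟩, rfl⟩

theorem IsHandledTriangle.isCherry_tip (h : G.IsSRGWith n k 1 μ) {p q y x z r : V}
    (ht : IsHandledTriangle G p q y x z r) (hyr : G.Adj y r) : IsCherry G y p r := by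
  obtain ⟨⟨hpq, hpy, hqy⟩, hx, hz, hxr, hzr⟩ := ht
  refine ⟨hpy.symm, hyr, ?_, fun hpr => ?_⟩
  · rintro rfl
    exact hz.2.2.2 hzr.symm
  · obtain rfl := common_unique_of_adj h hpy hpq hqy.symm hpr hyr
    exact hx.2.2.2 hxr.symm

theorem bijOn_isHandledTriangle_adj_tip (h : G.IsSRGWith n k 1 2) :
    Set.BijOn (fun (p, _, y, _, _, r) => (y, p, r))
      {(p, q, y, x, z, r) : V × V × V × V × V × V | IsHandledTriangle G p q y x z r ∧ G.Adj y r}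
      {(y, p, r) | IsCherry G y p r} := by
  refine ⟨fun _ ⟨ht, hyr⟩ => ht.isCherry_tip h hyr, ?_, ?_⟩
  · rintro ⟨p, q, y, x, z, r⟩ ⟨ht, hyr⟩ ⟨_, q', _, x', z', _⟩ ⟨ht', -⟩ heq
    obtain ⟨rfl, rfl, rfl⟩ : y = _ ∧ p = _ ∧ r = _ := by simpa only [Prod.mk.injEq] using heq
    obtain rfl := common_unique_of_adj h ht.1.2.1 ht.1.1 ht.1.2.2.symm ht'.1.1 ht'.1.2.2.symm
    obtain rfl := ((ht.isCherry_tip h hyr).existsUnique_opposite h).unique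
      ⟨ht.handle_ne_tip, ht.2.1.2.1, ht.2.2.2.1.symm⟩
      ⟨ht'.handle_ne_tip, ht'.2.1.2.1, ht'.2.2.2.1.symm⟩
    obtain rfl := ((ht.symm.isCherry_tip h hyr).existsUnique_opposite h).unique
      ⟨ht.symm.handle_ne_tip, ht.2.2.1.2.1, ht.2.2.2.2.symm⟩
      ⟨ht'.symm.handle_ne_tip, ht'.2.2.1.2.1, ht'.2.2.2.2.symm⟩
    rfl
  · rintro ⟨y, p, r⟩ hp
    obtain ⟨q, ⟨hyq, hpq⟩, -⟩ := existsUnique_common_of_adj h hp.1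
    have hq : IsCherry G y q r := hp.third_left h hyq hpq
    obtain ⟨x, ⟨hxy, hpx, hrx⟩, -⟩ := hp.existsUnique_opposite h
    obtain ⟨z, ⟨hzy, hqz, hrz⟩, -⟩ := hq.existsUnique_opposite h
    have hx : IsCherry G p q x := (hp.opposite h hxy hpx hrx).third_left h hpq hyq
    have hz : IsCherry G q p z := (hq.opposite h hzy hqz hrz).third_left h hpq.symm hp.1
    exact ⟨(p, q, y, x, z, r), ⟨⟨⟨hpq, hp.1.symm, hyq.symm⟩, hx, hz, hrx.symm, hrz.symm⟩, hp.2.1⟩,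
      rfl⟩

-- By the two bijections, `x ~ z` and `y ~ r` hold equally often, namely once for each cherry.
theorem ncard_isHandledTriangle_not_adj_handle_adj_tip (h : G.IsSRGWith n k 1 2) :
    ({(p, q, y, x, z, r) | (IsHandledTriangle G p q y x z r ∧ G.Adj y r) ∧ ¬ G.Adj x z} :
      Set (V × V × V × V × V × V)).ncard =
    ({(p, q, y, x, z, r) | (IsHandledTriangle G p q y x z r ∧ G.Adj x z) ∧ ¬ G.Adj y r} :
      Set (V × V × V × V × V × V)).ncard :=
  ncard_and_and_not_comm
    ((bijOn_isHandledTriangle_adj_tip h).ncard_eq.trans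
      (bijOn_isHandledTriangle_adj_handle h).ncard_eq.symm)

theorem isHexFrame_and_adj_iff (h : G.IsSRGWith n k 1 μ) {x y z p q r : V} :
    IsHexFrame G x y z p q r ∧ G.Adj p q ↔
      (IsHandledTriangle G p q y x z r ∧ ¬ G.Adj x z) ∧ ¬ G.Adj y r := by
  constructor
  · rintro ⟨⟨⟨hxy, hyz, hzx⟩, ⟨hxp, hyp, -⟩, ⟨hyq, hzq, -⟩, hzr, hxr, hyr⟩, hpq⟩
    have hx : IsCherry G p y x := ⟨hyp.symm, hxp.symm, hxy.symm⟩
    have hz : IsCherry G q y z := ⟨hyq.symm, hzq.symm, hyz⟩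
    exact ⟨⟨⟨⟨hpq, hyp.symm, hyq.symm⟩, hx.third_left h hpq hyq,
      hz.third_left h hpq.symm hyp, hxr, hzr⟩, fun hxz => hzx.2 hxz.symm⟩, hyr⟩
  · rintro ⟨⟨⟨⟨hpq, hpy, hqy⟩, hx, hz, hxr, hzr⟩, hxz⟩, hyr⟩
    have hzx : z ≠ x := fun hzx => hx.2.2.2 (hzx ▸ hz.2.1)
    exact ⟨⟨⟨(hx.third_left h hpy hqy).2.2.symm, (hz.third_left h hqy hpy).2.2,
      hzx, fun hzx => hxz hzx.symm⟩,
      ⟨hx.2.1.symm, hpy.symm, fun hzp => hz.2.2.2 hzp.symm⟩,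
      ⟨hqy.symm, hz.2.1.symm, fun hxq => hx.2.2.2 hxq.symm⟩, hzr, hxr, hyr⟩, hpq⟩

theorem IsHexFrame.isCherry_of_two_chords (h : G.IsSRGWith n k 1 μ) {x y z p q r : V}
    (hf : IsHexFrame G x y z p q r) (hpq : G.Adj p q) (hqr : G.Adj q r) : IsCherry G q p r := by
  obtain ⟨⟨-, hyz, -⟩, ⟨-, hyp, -⟩, ⟨hyq, -, -⟩, hzr, -, hyr⟩ := hf
  have hy : IsCherry G q y r := by
    refine ⟨hyq.symm, hqr, ?_, hyr⟩
    rintro rfl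
    exact hyz.2 hzr.symm
  exact hy.third_left h hpq.symm hyp

theorem IsCherry.exists_isHexFrame (h : G.IsSRGWith n k 1 2) {p q r : V}
    (hc : IsCherry G q p r) : ∃ x y z, IsHexFrame G x y z p q r := by
  obtain ⟨y, ⟨hqy, hpy⟩, -⟩ := existsUnique_common_of_adj h hc.1
  obtain ⟨z, ⟨hqz, hrz⟩, -⟩ := existsUnique_common_of_adj h hc.2.1
  obtain ⟨x, ⟨hxq, hpx, hrx⟩, -⟩ := hc.existsUnique_opposite h
  have hpqx : IsCherry G p q x := hc.opposite h hxq hpx hrx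
  have hrqx : IsCherry G r q x := hc.symm.opposite h hxq hrx hpx
  have hqyr : IsCherry G q y r := hc.third_left h hqy hpy
  have hqzp : IsCherry G q z p := hc.symm.third_left h hqz hrz
  have hqzy : IsCherry G q z y := hqyr.symm.third_left h hqz hrz
  exact ⟨x, y, z,
    ⟨(hpqx.third_left h hpy hqy).2.2.symm, hqzy.2.2.symm, (hrqx.third_left h hrz hqz).2.2⟩,
    ⟨hpx.symm, hpy.symm, hqzp.2.2.2⟩, ⟨hqy.symm, hqz.symm, fun hxq => hpqx.2.2.2 hxq.symm⟩,
    hrz.symm, hrx.symm, hqyr.2.2.2⟩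

theorem bijOn_isHexFrame_two_chords (h : G.IsSRGWith n k 1 2) :
    Set.BijOn (fun ((_, _, _), p, q, r) => (q, p, r))
      {((x, y, z), p, q, r) : (V × V × V) × V × V × V |
        IsHexFrame G x y z p q r ∧ G.Adj p q ∧ G.Adj q r}
      {(q, p, r) | IsCherry G q p r} := by
  refine ⟨fun _ ⟨hf, hpq, hqr⟩ => hf.isCherry_of_two_chords h hpq hqr, ?_, ?_⟩
  · rintro ⟨⟨x, y, z⟩, p, q, r⟩ ⟨hf, hpq, hqr⟩ ⟨⟨x', y', z'⟩, _, _, _⟩ ⟨hf', -, -⟩ heq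
    obtain ⟨rfl, rfl, rfl⟩ : q = _ ∧ p = _ ∧ r = _ := by simpa only [Prod.mk.injEq] using heq
    have hc := hf.isCherry_of_two_chords h hpq hqr
    obtain ⟨⟨hxy, -, -⟩, ⟨hxp, hyp, -⟩, ⟨hyq, hzq, -⟩, hzr, hxr, -⟩ := hf
    obtain ⟨⟨hxy', -, -⟩, ⟨hxp', hyp', -⟩, ⟨hyq', hzq', -⟩, hzr', hxr', -⟩ := hf'
    obtain rfl := common_unique_of_adj h hpq hyp.symm hyq.symm hyp'.symm hyq'.symm
    obtain rfl := common_unique_of_adj h hqr hzq.symm hzr.symm hzq'.symm hzr'.symm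
    obtain rfl := (hc.existsUnique_opposite h).unique
      ⟨ne_of_apply_ne (G.Adj · y) (by simp [hxy.2, hyq.symm]), hxp.symm, hxr.symm⟩
      ⟨ne_of_apply_ne (G.Adj · y) (by simp [hxy'.2, hyq.symm]), hxp'.symm, hxr'.symm⟩
    rfl
  · rintro ⟨q, p, r⟩ hc
    obtain ⟨x, y, z, hf⟩ := hc.exists_isHexFrame h
    exact ⟨((x, y, z), p, q, r), ⟨hf, hc.1.symm, hc.2.1⟩, rfl⟩

theorem cast_ncard_isHexFrame_one_chord (h : G.IsSRGWith n k 1 2) :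
    ({((x, y, z), p, q, r) | IsHexFrame G x y z p q r ∧ G.Adj p q} :
      Set ((V × V × V) × V × V × V)).ncard +
    ({(p, q, y, x, z, r) | (IsHandledTriangle G p q y x z r ∧ G.Adj x z) ∧ ¬ G.Adj y r} :
      Set (V × V × V × V × V × V)).ncard = (n * k * (k - 2) * (k - 3) * 2 : ℤ) := by
  have hframe : ({((x, y, z), p, q, r) | IsHexFrame G x y z p q r ∧ G.Adj p q} :
      Set ((V × V × V) × V × V × V)).ncard =
      ({(p, q, y, x, z, r) | (IsHandledTriangle G p q y x z r ∧ ¬ G.Adj x z) ∧ ¬ G.Adj y r} :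
        Set (V × V × V × V × V × V)).ncard :=
    Set.ncard_congr'
      { toFun := fun t => ⟨(t.1.2.1, t.1.2.2.1, t.1.1.2.1, t.1.1.1, t.1.1.2.2, t.1.2.2.2),
          (isHexFrame_and_adj_iff h).1 t.2⟩
        invFun := fun t => ⟨((t.1.2.2.2.1, t.1.2.2.1, t.1.2.2.2.2.1), t.1.1, t.1.2.1,
          t.1.2.2.2.2.2), (isHexFrame_and_adj_iff h).2 t.2⟩ }
  have hsplit := ncard_and_add_ncard_and_not (α := V × V × V × V × V × V)
    (fun (p, q, y, x, z, r) => IsHandledTriangle G p q y x z r ∧ ¬ G.Adj x z)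
    (fun (_, _, y, _, _, r) => G.Adj y r)
  have hcomm : ({(p, q, y, x, z, r) |
      (IsHandledTriangle G p q y x z r ∧ ¬ G.Adj x z) ∧ G.Adj y r} :
      Set (V × V × V × V × V × V)) =
      {(p, q, y, x, z, r) | (IsHandledTriangle G p q y x z r ∧ G.Adj y r) ∧ ¬ G.Adj x z} :=
    Set.ext fun _ => and_right_comm
  have htotal := cast_ncard_isHandledTriangle_not_adj h
  rw [← hsplit, hcomm, ncard_isHandledTriangle_not_adj_handle_adj_tip h, ← hframe] at htotal
  push_cast at htotal
  rw [← htotal, add_comm]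

theorem cast_ncard_isHexFrame_no_chord_eq (h : G.IsSRGWith n k 1 μ) :
    (({((x, y, z), p, q, r) | IsHexFrame G x y z p q r ∧
      ¬ G.Adj p q ∧ ¬ G.Adj q r ∧ ¬ G.Adj r p} : Set ((V × V × V) × V × V × V)).ncard : ℤ) =
    ({((x, y, z), p, q, r) | IsHexFrame G x y z p q r} : Set ((V × V × V) × V × V × V)).ncard -
      3 * ({((x, y, z), p, q, r) | IsHexFrame G x y z p q r ∧ G.Adj p q} :
        Set ((V × V × V) × V × V × V)).ncard +
      3 * ({((x, y, z), p, q, r) | IsHexFrame G x y z p q r ∧ G.Adj p q ∧ G.Adj q r} :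
        Set ((V × V × V) × V × V × V)).ncard := by
  have hqr := ncard_isHexFrame_rotate G fun _ q r => G.Adj q r
  have hrp := ncard_isHexFrame_rotate G fun p _ r => G.Adj r p
  have hqrp := ncard_isHexFrame_rotate G fun p q r => G.Adj q r ∧ G.Adj r p
  have hrpq := ncard_isHexFrame_rotate G fun p q r => G.Adj r p ∧ G.Adj p q
  refine (cast_ncard_and_not_and_not_and_not
    (fun ((x, y, z), p, q, r) => IsHexFrame G x y z p q r) (fun (_, p, q, _) => G.Adj p q)
    (fun (_, _, q, r) => G.Adj q r) (fun (_, p, _, r) => G.Adj r p)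
    fun _ hf hpq hqr hrp => (hf.isCherry_of_two_chords h hpq hqr).2.2.2 hrp.symm).trans ?_
  rw [hrpq, hqrp, hrp, hqr]
  ring

theorem cast_ncard_isHexFrame_no_chord (h : G.IsSRGWith n k 1 2) :
    ({((x, y, z), p, q, r) | IsHexFrame G x y z p q r ∧
      ¬ G.Adj p q ∧ ¬ G.Adj q r ∧ ¬ G.Adj r p} : Set ((V × V × V) × V × V × V)).ncard =
    (n * k * (k - 2) * (2 * k ^ 2 - 21 * k + 53) +
      3 * ({(p, q, y, x, z, r) | (IsHandledTriangle G p q y x z r ∧ G.Adj x z) ∧ ¬ G.Adj y r} :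
        Set (V × V × V × V × V × V)).ncard : ℤ) := by
  have hframe := cast_ncard_isHexFrame_add h
  have hone := cast_ncard_isHexFrame_one_chord h
  have hcherry := cast_ncard_isCherry h
  have hpar := mul_compl_degree_mul_eq h
  rw [cast_ncard_isClaw h, cast_ncard_isIndepTriple h] at hframe
  rw [cast_ncard_isHexFrame_no_chord_eq h, (bijOn_isHexFrame_two_chords h).ncard_eq, hcherry]
  push_cast at *
  linear_combination hframe - 3 * hone + (4 * (n - 2 * k) + 2 * (k * (k - 2)) : ℤ) * hpar

theorem doublyLinkedTriangles_adj_iff_of_isHandledTriangle (h : G.IsSRGWith n k 1 μ)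
    {p q y x z r : V}
    (ht : (IsHandledTriangle G p q y x z r ∧ G.Adj x z) ∧ ¬ G.Adj y r) (a b : Fin 6)
    (hab : a < b) : G.Adj (![p, q, y, x, z, r] a) (![p, q, y, x, z, r] b) ↔
      doublyLinkedTriangles.Adj a b := by
  obtain ⟨⟨⟨⟨hpq, hpy, hqy⟩, ⟨-, hpx, hqx⟩, ⟨-, hqz, hpz⟩, hxr, hzr⟩, hxz⟩, hyr⟩ := ht
  have hpr : ¬ G.Adj p r := fun hpr =>
    hpz.1 (common_unique_of_adj h hxr hpx.symm hpr.symm hxz hzr.symm)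
  have hqr : ¬ G.Adj q r := fun hqr =>
    hqx.1 (common_unique_of_adj h hzr hqz.symm hqr.symm hxz.symm hxr.symm)
  have hyx : ¬ G.Adj y x := fun hyx =>
    hqx.1 (common_unique_of_adj h hpy hpq hqy.symm hpx hyx)
  have hyz : ¬ G.Adj y z := fun hyz =>
    hpz.1 (common_unique_of_adj h hqy hpq.symm hpy.symm hqz hyz)
  have hqx' := hqx.2
  have hpz' := hpz.2
  fin_cases a <;> fin_cases b <;>
    first
      | exact absurd hab (by decide)
      | exact iff_of_true ‹_› (by decide)
      | exact iff_of_false ‹_› (by decide)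

theorem inducedCount_doublyLinkedTriangles_mul_four (h : G.IsSRGWith n k 1 μ) :
    inducedCount G doublyLinkedTriangles * 4 =
      ({(p, q, y, x, z, r) | (IsHandledTriangle G p q y x z r ∧ G.Adj x z) ∧ ¬ G.Adj y r} :
        Set (V × V × V × V × V × V)).ncard := by
  rw [← card_aut_doublyLinkedTriangles, ← card_embedding_eq_inducedCount_mul_card_aut,
    ← Nat.card_coe_set_eq]
  exact Nat.card_congr
    { toFun := fun f => ⟨(f 0, f 1, f 2, f 3, f 4, f 5), isHandledTriangle_of_embedding f⟩
      invFun := fun ⟨(p, q, y, x, z, r), ht⟩ => embeddingOfTwinFree (by decide) ![p, q, y, x, z, r]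
        (doublyLinkedTriangles_adj_iff_of_isHandledTriangle h ht)
      left_inv := fun f => by
        ext a
        fin_cases a <;> rfl
      right_inv := fun _ => rfl }

end StronglyRegular

theorem mainTheorem1 {V : Type*} [Fintype V] [DecidableEq V]
    (G : SimpleGraph V) [DecidableRel G.Adj]
    (hI : EdgesInUniqueTriangle G) (hII : NonEdgesInUniqueQuadrilateral G) :
    ∃ k : ℕ, G.IsSRGWith (Fintype.card V) k 1 2 ∧
      (inducedCount G (SimpleGraph.cycleGraph 6) : ℚ) =
        1 / 12 * (Fintype.card V : ℚ) * k * (k - 2) * (2 * (k : ℚ) ^ 2 - 21 * k + 53)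
          + inducedCount G doublyLinkedTriangles ∧
      1 / 12 * (Fintype.card V : ℚ) * k * (k - 2) * (2 * (k : ℚ) ^ 2 - 21 * k + 53)
        ≤ inducedCount G (SimpleGraph.cycleGraph 6) := by
  obtain ⟨k, h⟩ := exists_isSRGWith hI hII
  have hcount := cast_ncard_isHexFrame_no_chord h
  rw [← inducedCount_cycleGraph_six_mul_twelve,
    ← inducedCount_doublyLinkedTriangles_mul_four h] at hcount
  have hcountQ := congrArg (Int.cast : ℤ → ℚ) hcount
  push_cast at hcountQ
  have heq : (inducedCount G (SimpleGraph.cycleGraph 6) : ℚ) =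
      1 / 12 * (Fintype.card V : ℚ) * k * (k - 2) * (2 * (k : ℚ) ^ 2 - 21 * k + 53)
        + inducedCount G doublyLinkedTriangles := by
    linear_combination hcountQ / 12
  exact ⟨k, h, heq, heq ▸ le_add_of_nonneg_right (Nat.cast_nonneg _)⟩
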